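/- Let $\mathbb{D}$ be the open unit disk. Let $\mathcal{H}$ be the class of harmonic mappings $f=h+\overline{g}$ of $\mathbb{D}$, with $h$ and $g$ analytic in $\mathbb{D}$ and $h(0)=h'(0)-1=0$, that are locally univalent and sense-preserving (i.e. have positive Jacobian) in $\mathbb{D}$. Let $\mathcal{S}_H^0$ be the class of those $f=h+\overline{g}\in\mathcal{H}$ that are univalent in $\mathbb{D}$ and satisfy $g'(0)=0$. For $\gamma\in\mathbb{R}$, a mapping $f$ of $\mathbb{D}$ is called convex in the direction $\gamma$ if every line parallel to the line joining $0$ to $e^{i\gamma}$ has connected (possibly empty) intersection with $f(\mathbb{D})$. Let $\mu,\nu,\varphi\in\mathbb{R}$ and, for $z\in\mathbb{D}$, put $$\psi_{\mu,\nu}(z)=\frac{1}{1-2ze^{i\mu}\cos\nu+z^2e^{2i\mu}},\qquad \phi(z)=\int_0^z\psi_{\mu,\nu}(\xi)\,d\xi .$$ For $k=1,2$ let $f_k=h_k+\overline{g_k}\in\mathcal{H}$ satisfy $$h_k(z)-e^{2i\varphi}g_k(z)=\phi(z),\qquad z\in\mathbb{D}.$$ For $\eta\in\mathbb{C}$ let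 $$f=h+\overline{g},\qquad h=\eta h_1+(1-\eta)h_2,\qquad g=\eta g_1+(1-\eta)g_2 .$$ Then: 1. For every real $\eta$ with $0\le\eta\le1$, $f\in\mathcal{S}_H^0$ and $f$ is convex in the direction $\varphi$. 2. If $\alpha_1,\alpha_2\in(0,1]$ and the dilatations $\omega_k=g_k'/h_k'$ satisfy $|\omega_k(z)|<\alpha_k$ for all $z\in\mathbb{D}$, $k=1,2$, then for every $\eta\in\mathbb{C}$ with $$|\eta|\le\frac{(1-\alpha_1)(1-\alpha_2)}{2(\alpha_1+\alpha_2)},$$ $f\in\mathcal{S}_H^0$ and $f$ is convex in the direction $\varphi$. -/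

import Mathlib

open scoped ComplexConjugate Topology

noncomputable section

namespace HarmonicMapping

/-- The open unit disk `𝔻` of the complex plane. -/
def unitDisk : Set ℂ := Metric.ball (0 : ℂ) 1

/-- The mapping `h + conj g` with analytic part `h` and co-analytic part `g`. -/
def harmonicMap (h g : ℂ → ℂ) (z : ℂ) : ℂ := h z + conj (g z)

/-- The Jacobian of a planar mapping at `z`: the determinant of its real derivative. -/
def jacobian (f : ℂ → ℂ) (z : ℂ) : ℝ := (fderiv ℝ f z).det

/-- `f` is injective near every point of the disk. -/
def LocallyUnivalent (f : ℂ → ℂ) : Prop :=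
  ∀ z ∈ unitDisk, ∃ U ∈ 𝓝 z, Set.InjOn f U

/-- `f` has positive Jacobian at every point of the disk. -/
def SensePreserving (f : ℂ → ℂ) : Prop :=
  ∀ z ∈ unitDisk, 0 < jacobian f z

/-- The (second complex) dilatation `ω = g' / h'` of `h + conj g`. -/
def dilatation (h g : ℂ → ℂ) (z : ℂ) : ℂ := deriv g z / deriv h z

/-- The class `𝓗`: locally univalent, sense-preserving harmonic mappings `h + conj g` of the unit
disk, with `h` and `g` analytic, `h 0 = 0` and `h' 0 = 1`. A harmonic mapping of the disk
determines the pair `(h, g)` on the disk once `h 0 = 0` is required. -/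
structure ClassH (h g : ℂ → ℂ) : Prop where
  analytic_h : DifferentiableOn ℂ h unitDisk
  analytic_g : DifferentiableOn ℂ g unitDisk
  locallyUnivalent : LocallyUnivalent (harmonicMap h g)
  sensePreserving : SensePreserving (harmonicMap h g)
  h_zero : h 0 = 0
  deriv_h_zero : deriv h 0 = 1

/-- The class `S_H`: the univalent members of `𝓗`. -/
structure ClassSH (h g : ℂ → ℂ) : Prop extends ClassH h g where
  univalent : Set.InjOn (harmonicMap h g) unitDisk

/-- The class `S_H^0`: the members of `S_H` with `g' 0 = 0`. -/
structure ClassSH0 (h g : ℂ → ℂ) : Prop extends ClassSH h g where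
  deriv_g_zero : deriv g 0 = 0

/-- The line through `a` parallel to the line joining the origin to `e^{iγ}`. -/
def directedLine (a : ℂ) (γ : ℝ) : Set ℂ :=
  {w | ∃ t : ℝ, w = a + (t : ℂ) * Complex.exp (Complex.I * γ)}

/-- `Ω` is convex in the direction `γ`: every line parallel to the line joining the origin to
`e^{iγ}` has connected (possibly empty) intersection with `Ω`. -/
def SetConvexInDirection (γ : ℝ) (Ω : Set ℂ) : Prop :=
  ∀ a : ℂ, IsPreconnected (directedLine a γ ∩ Ω)

/-- A mapping of the disk is convex in the direction `γ` if its image is. -/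
def ConvexInDirection (γ : ℝ) (f : ℂ → ℂ) : Prop :=
  SetConvexInDirection γ (f '' unitDisk)

/-- `ψ_{μ,ν}(z) = 1 / (1 - 2 z e^{iμ} cos ν + z² e^{2iμ})`; the denominator has no zero in the
open unit disk. -/
def psi (μ ν : ℝ) (z : ℂ) : ℂ :=
  (1 - 2 * z * Complex.exp (Complex.I * μ) * (Real.cos ν : ℂ)
    + z ^ 2 * Complex.exp (2 * Complex.I * μ))⁻¹

/-- `∫_0^z ψ_{μ,ν}(ξ) dξ`, taken along the segment `ξ = t z`, `0 ≤ t ≤ 1`. -/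
def phi (μ ν : ℝ) (z : ℂ) : ℂ := ∫ t in (0 : ℝ)..1, psi μ ν ((t : ℂ) * z) * z

/-- `η u₁ + (1 - η) u₂`. -/
def combo (η : ℂ) (u₁ u₂ : ℂ → ℂ) (z : ℂ) : ℂ := η * u₁ z + (1 - η) * u₂ z

end HarmonicMapping

end

namespace HarmonicMapping

lemma isOpen_unitDisk : IsOpen unitDisk := Metric.isOpen_ball

lemma mem_unitDisk {z : ℂ} : z ∈ unitDisk ↔ ‖z‖ < 1 := by simp [unitDisk]

lemma zero_mem_unitDisk : (0 : ℂ) ∈ unitDisk := by simp [mem_unitDisk]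

lemma jacobian_harmonicMap {h g : ℂ → ℂ} {z : ℂ} (hh : DifferentiableAt ℂ h z)
    (hg : DifferentiableAt ℂ g z) :
    jacobian (harmonicMap h g) z = ‖deriv h z‖ ^ 2 - ‖deriv g z‖ ^ 2 := by
  have h1 : HasFDerivAt h ((ContinuousLinearMap.toSpanSingleton ℂ (deriv h z)).restrictScalars ℝ) z :=
    hh.hasDerivAt.hasFDerivAt.restrictScalars ℝ
  have h2 : HasFDerivAt g ((ContinuousLinearMap.toSpanSingleton ℂ (deriv g z)).restrictScalars ℝ) z :=
    hg.hasDerivAt.hasFDerivAt.restrictScalars ℝ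
  have h3 := h1.add ((Complex.conjCLE.hasFDerivAt (x := g z)).comp z h2)
  have h4 : HasFDerivAt (harmonicMap h g) _ z := h3
  rw [jacobian, h4.fderiv, ContinuousLinearMap.det, ← LinearMap.det_toMatrix Complex.basisOneI,
    Matrix.det_fin_two]
  simp [LinearMap.toMatrix_apply, ← Complex.normSq_eq_norm_sq, Complex.normSq_apply]
  ring

lemma sensePreserving_harmonicMap_iff {h g : ℂ → ℂ} (hh : DifferentiableOn ℂ h unitDisk)
    (hg : DifferentiableOn ℂ g unitDisk) :
    SensePreserving (harmonicMap h g) ↔ ∀ z ∈ unitDisk, ‖deriv g z‖ < ‖deriv h z‖ := by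
  refine forall₂_congr fun z hz => ?_
  have hD := isOpen_unitDisk.mem_nhds hz
  rw [jacobian_harmonicMap (hh.differentiableAt hD) (hg.differentiableAt hD), sub_pos]
  exact sq_lt_sq₀ (norm_nonneg _) (norm_nonneg _)

lemma norm_lt_norm_add_iff (P X : ℂ) : ‖X‖ < ‖P + X‖ ↔ 0 < ‖P‖ ^ 2 + 2 * (conj P * X).re := by
  rw [← sq_lt_sq₀ (norm_nonneg _) (norm_nonneg _)]
  simp only [← Complex.normSq_eq_norm_sq, Complex.normSq_apply, Complex.add_re, Complex.add_im,
    Complex.mul_re, Complex.conj_re, Complex.conj_im]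
  constructor <;> intro <;> linarith

lemma norm_combo_lt_of_mem_Icc {P X₁ X₂ : ℂ} (h₁ : ‖X₁‖ < ‖P + X₁‖) (h₂ : ‖X₂‖ < ‖P + X₂‖)
    {η : ℝ} (h0 : 0 ≤ η) (h1 : η ≤ 1) :
    ‖η * X₁ + (1 - η) * X₂‖ < ‖P + (η * X₁ + (1 - η) * X₂)‖ := by
  rw [norm_lt_norm_add_iff] at *
  have : (conj P * (η * X₁ + (1 - η) * X₂)).re
      = η * (conj P * X₁).re + (1 - η) * (conj P * X₂).re := by
    simp; ring
  rw [this]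
  rcases h0.eq_or_lt with rfl | h0
  · simpa using h₂
  · nlinarith [mul_pos h0 h₁, mul_nonneg (sub_nonneg.2 h1) h₂.le]

lemma norm_combo_lt_of_norm_le {P X₁ X₂ η : ℂ} {α₁ α₂ : ℝ} (hα₂ : α₂ ≤ 1)
    (h₁ : ‖X₁‖ < ‖P + X₁‖) (h₂ : ‖X₂‖ < ‖P + X₂‖)
    (hω₁ : ‖X₁‖ < α₁ * ‖P + X₁‖) (hω₂ : ‖X₂‖ < α₂ * ‖P + X₂‖)
    (hη : ‖η‖ ≤ (1 - α₁) * (1 - α₂) / (2 * (α₁ + α₂))) :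
    ‖η * X₁ + (1 - η) * X₂‖ < ‖P + (η * X₁ + (1 - η) * X₂)‖ := by
  have hH₁ : 0 < ‖P + X₁‖ := (norm_nonneg _).trans_lt h₁
  have hH₂ : 0 < ‖P + X₂‖ := (norm_nonneg _).trans_lt h₂
  have p₁ : 0 < α₁ := pos_of_mul_pos_left ((norm_nonneg _).trans_lt hω₁) hH₁.le
  have p₂ : 0 < α₂ := pos_of_mul_pos_left ((norm_nonneg _).trans_lt hω₂) hH₂.le
  rw [le_div_iff₀ (by positivity)] at hη
  have hP1 : (1 - α₁) * ‖P + X₁‖ ≤ ‖P + X₂‖ + ‖X₂‖ := by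
    have a1 : ‖P + X₁‖ ≤ ‖P‖ + ‖X₁‖ := norm_add_le _ _
    have a2 : ‖P‖ ≤ ‖P + X₂‖ + ‖X₂‖ := by simpa using norm_sub_le (P + X₂) X₂
    linarith
  have hkey : ‖P‖ * ‖X₁ - X₂‖ ≤ (α₁ + α₂) * (‖P + X₁‖ * ‖P + X₂‖) := by
    rw [← norm_mul, show P * (X₁ - X₂) = X₁ * (P + X₂) - X₂ * (P + X₁) by ring]
    refine (norm_sub_le _ _).trans ?_
    rw [norm_mul, norm_mul]
    nlinarith [mul_le_mul_of_nonneg_right hω₁.le hH₂.le, mul_le_mul_of_nonneg_right hω₂.le hH₁.le]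
  have hlt : 2 * ‖η‖ * (‖P‖ * ‖X₁ - X₂‖) < ‖P + X₂‖ ^ 2 - ‖X₂‖ ^ 2 := by
    calc 2 * ‖η‖ * (‖P‖ * ‖X₁ - X₂‖)
        ≤ 2 * ‖η‖ * ((α₁ + α₂) * (‖P + X₁‖ * ‖P + X₂‖)) := by gcongr
      _ = ‖η‖ * (2 * (α₁ + α₂)) * (‖P + X₁‖ * ‖P + X₂‖) := by ring
      _ ≤ (1 - α₁) * (1 - α₂) * (‖P + X₁‖ * ‖P + X₂‖) := by gcongr
      _ = (1 - α₁) * ‖P + X₁‖ * ((1 - α₂) * ‖P + X₂‖) := by ring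
      _ ≤ (‖P + X₂‖ + ‖X₂‖) * ((1 - α₂) * ‖P + X₂‖) := by
        have : 0 ≤ 1 - α₂ := by linarith
        gcongr
      _ < (‖P + X₂‖ + ‖X₂‖) * (‖P + X₂‖ - ‖X₂‖) := by
        have : 0 < ‖P + X₂‖ + ‖X₂‖ := by positivity
        gcongr
        linarith
      _ = _ := by ring
  have hsq : ‖P + X₂‖ ^ 2 - ‖X₂‖ ^ 2 = ‖P‖ ^ 2 + 2 * (conj P * X₂).re := by
    simp only [← Complex.normSq_eq_norm_sq, Complex.normSq_apply, Complex.add_re, Complex.add_im,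
      Complex.mul_re, Complex.conj_re, Complex.conj_im]
    ring
  rw [norm_lt_norm_add_iff]
  have hsplit : conj P * (η * X₁ + (1 - η) * X₂)
      = conj P * X₂ + conj P * (η * (X₁ - X₂)) := by ring
  have hre : -(‖η‖ * (‖P‖ * ‖X₁ - X₂‖)) ≤ (conj P * (η * (X₁ - X₂))).re := by
    have := (abs_le.1 (Complex.abs_re_le_norm (conj P * (η * (X₁ - X₂))))).1
    rw [norm_mul, norm_mul, RCLike.norm_conj] at this
    linarith
  rw [hsplit, Complex.add_re]
  linarith

lemma norm_exp_I_mul (γ : ℝ) : ‖Complex.exp (Complex.I * γ)‖ = 1 := by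
  rw [mul_comm]; exact Complex.norm_exp_ofReal_mul_I γ

lemma exp_two_I_mul (γ : ℝ) :
    Complex.exp (2 * Complex.I * γ) = Complex.exp (Complex.I * γ) ^ 2 := by
  rw [← Complex.exp_nat_mul]; congr 1; push_cast; ring

/-- Shearing in the direction `γ` a conformal map `Φ` of the disk onto a convex domain. -/
theorem shear {γ : ℝ} {h g Φ Φ' Ψ : ℂ → ℂ} {Ω : Set ℂ} (hΩc : Convex ℝ Ω) (hΩo : IsOpen Ω)
    (hΦm : Set.MapsTo Φ unitDisk Ω) (hΨm : Set.MapsTo Ψ Ω unitDisk)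
    (hΨΦ : ∀ z ∈ unitDisk, Ψ (Φ z) = z) (hΦΨ : ∀ w ∈ Ω, Φ (Ψ w) = w)
    (hΨd : DifferentiableOn ℂ Ψ Ω) (hΦd : ∀ z ∈ unitDisk, HasDerivAt Φ (Φ' z) z)
    (hh : DifferentiableOn ℂ h unitDisk) (hg : DifferentiableOn ℂ g unitDisk)
    (hshear : ∀ z ∈ unitDisk, h z - Complex.exp (2 * Complex.I * γ) * g z = Φ z)
    (hlt : ∀ z ∈ unitDisk, ‖deriv g z‖ < ‖deriv h z‖) :
    Set.InjOn (harmonicMap h g) unitDisk ∧ ConvexInDirection γ (harmonicMap h g) := by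
  set e := Complex.exp (Complex.I * γ) with he
  have he1 : ‖e‖ = 1 := norm_exp_I_mul γ
  have hee : e * conj e = 1 := by rw [Complex.mul_conj']; simp [he1]
  have he0 : e ≠ 0 := Complex.exp_ne_zero _
  simp only [exp_two_I_mul, ← he] at hshear
  let q : ℂ → ℝ := fun w => 2 * (e * g (Ψ w)).re
  have hq : ∀ z ∈ unitDisk, harmonicMap h g z = Φ z + e * (q (Φ z) : ℂ) := by
    intro z hz
    have h2 : (2 * (e * g z).re : ℂ) = e * g z + conj (e * g z) := by
      rw [Complex.add_conj]; push_cast; ring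
    simp only [q, hΨΦ z hz, harmonicMap]
    push_cast
    rw [h2, ← hshear z hz, map_mul]
    linear_combination (-conj (g z)) * hee
  have hline : ∀ a : ℂ, ∀ t : ℝ, a + t * e ∈ Ω →
      ∃ k' : ℝ, 0 < k' ∧ HasDerivAt (fun t : ℝ => t + q (a + t * e)) k' t := by
    intro a t ht
    set w := a + t * e with hw
    have hz := hΨm ht
    have hD := isOpen_unitDisk.mem_nhds hz
    have dΨ := (hΨd.differentiableAt (hΩo.mem_nhds ht)).hasDerivAt
    have dg := (hg.differentiableAt hD).hasDerivAt
    have dh := (hh.differentiableAt hD).hasDerivAt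
    have e1 : Φ' (Ψ w) * deriv Ψ w = 1 := by
      have := (hΦd _ hz).comp w dΨ
      refine this.unique ((hasDerivAt_id w).congr_of_eventuallyEq ?_)
      filter_upwards [hΩo.mem_nhds ht] with x hx using hΦΨ x hx
    have e2 : deriv h (Ψ w) - e ^ 2 * deriv g (Ψ w) = Φ' (Ψ w) := by
      have := dh.sub (dg.const_mul (e ^ 2))
      refine this.unique ((hΦd _ hz).congr_of_eventuallyEq ?_)
      filter_upwards [hD] with x hx using hshear x hx
    have dl : HasDerivAt (fun s : ℝ => a + (s : ℂ) * e) e t := by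
      simpa using ((Complex.ofRealCLM.hasDerivAt (x := t)).mul_const e).const_add a
    have dk := ((dg.comp w dΨ).comp t dl).const_mul e
    have dre : HasDerivAt (fun s : ℝ => q (a + s * e))
        (2 * (e * (deriv g (Ψ w) * deriv Ψ w * e)).re) t :=
      ((Complex.reCLM.hasFDerivAt).comp_hasDerivAt t dk).const_mul 2
    refine ⟨_, ?_, (hasDerivAt_id t).add dre⟩
    have hP : Φ' (Ψ w) ≠ 0 := left_ne_zero_of_mul_eq_one e1
    have hn := hlt _ hz
    rw [← one_mul ‖deriv g (Ψ w)‖, ← one_pow 2, ← he1, ← norm_pow, ← norm_mul,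
      ← sub_add_cancel (deriv h (Ψ w)) (e ^ 2 * deriv g (Ψ w)), e2, norm_lt_norm_add_iff] at hn
    have e3 : e * (deriv g (Ψ w) * deriv Ψ w * e) =
        conj (Φ' (Ψ w)) * (e ^ 2 * deriv g (Ψ w)) / ((‖Φ' (Ψ w)‖ ^ 2 : ℝ) : ℂ) := by
      push_cast
      rw [← Complex.mul_conj', eq_div_iff (by simpa using hP)]
      linear_combination (e ^ 2 * deriv g (Ψ w) * conj (Φ' (Ψ w))) * e1
    have hpos : 0 < ‖Φ' (Ψ w)‖ ^ 2 := by positivity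
    rw [e3, Complex.div_ofReal_re]
    have := div_pos hn hpos
    rw [add_div, div_self hpos.ne', mul_div_assoc] at this
    exact this
  have hI : ∀ a : ℂ, Convex ℝ {t : ℝ | a + t * e ∈ Ω} := by
    intro a s hs t ht c d hc hd hcd
    have := hΩc hs ht hc hd hcd
    simp only [Set.mem_ofPred_eq]
    convert this using 1
    simp only [Complex.real_smul, smul_eq_mul]
    have hcd' : (c : ℂ) + d = 1 := by exact_mod_cast hcd
    push_cast
    linear_combination (-a) * hcd'
  have hmono : ∀ a : ℂ, StrictMonoOn (fun t : ℝ => t + q (a + t * e)) {t : ℝ | a + t * e ∈ Ω} := by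
    intro a
    refine strictMonoOn_of_deriv_pos (hI a) ?_ ?_
    · intro t ht
      obtain ⟨k', -, hk⟩ := hline a t ht
      exact hk.continuousAt.continuousWithinAt
    · intro t ht
      obtain ⟨k', hp, hk⟩ := hline a t (interior_subset (s := {t : ℝ | a + t * e ∈ Ω}) ht)
      rwa [hk.deriv]
  constructor
  · intro z₁ hz₁ z₂ hz₂ heq
    rw [hq z₁ hz₁, hq z₂ hz₂] at heq
    have hw : Φ z₂ = Φ z₁ + ((q (Φ z₁) - q (Φ z₂) : ℝ) : ℂ) * e := by
      push_cast; linear_combination -heq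
    have h0 : (0 : ℝ) ∈ {t : ℝ | Φ z₁ + t * e ∈ Ω} := by simpa using hΦm hz₁
    have h1 : q (Φ z₁) - q (Φ z₂) ∈ {t : ℝ | Φ z₁ + t * e ∈ Ω} := by
      rw [Set.mem_ofPred_eq, ← hw]; exact hΦm hz₂
    have := (hmono (Φ z₁)).injOn h0 h1 (by simp only [← hw]; simp)
    rw [← this] at hw
    rw [← hΨΦ z₁ hz₁, ← hΨΦ z₂ hz₂, hw]
    simp
  · intro a
    have himg : directedLine a γ ∩ harmonicMap h g '' unitDisk =
        (fun t : ℝ => a + ((t + q (a + t * e) : ℝ) : ℂ) * e) '' {t : ℝ | a + t * e ∈ Ω} := by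
      ext y
      constructor
      · rintro ⟨⟨s, hs⟩, z, hz, rfl⟩
        rw [hq z hz] at hs ⊢
        have hw : a + ((s - q (Φ z) : ℝ) : ℂ) * e = Φ z := by
          push_cast; linear_combination -hs
        refine ⟨s - q (Φ z), ?_, ?_⟩
        · rw [Set.mem_ofPred_eq, hw]; exact hΦm hz
        · simp only [hw]
          push_cast; linear_combination -hs
      · rintro ⟨t, ht, rfl⟩
        refine ⟨⟨_, rfl⟩, Ψ (a + t * e), hΨm ht, ?_⟩
        rw [hq _ (hΨm ht), hΦΨ _ ht]
        push_cast; ring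
    rw [himg]
    refine (hI a).isPreconnected.image _ ?_
    intro t ht
    obtain ⟨k', -, hk⟩ := hline a t ht
    have hc := hk.continuousAt.continuousWithinAt (s := {t : ℝ | a + t * e ∈ Ω})
    exact continuousWithinAt_const.add
      ((Complex.continuous_ofReal.continuousAt.comp_continuousWithinAt hc).mul
        continuousWithinAt_const)

lemma phi_eq_of_hasDerivAt {μ ν : ℝ} {F : ℂ → ℂ} (h0 : F 0 = 0)
    (hF : ∀ z ∈ unitDisk, HasDerivAt F (psi μ ν z) z) (hc : ContinuousOn (psi μ ν) unitDisk)
    {z : ℂ} (hz : z ∈ unitDisk) : phi μ ν z = F z := by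
  have hmem : ∀ t ∈ Set.uIcc (0 : ℝ) 1, (t : ℂ) * z ∈ unitDisk := by
    intro t ht
    rw [Set.uIcc_of_le zero_le_one] at ht
    rw [mem_unitDisk] at *
    rw [norm_mul, Complex.norm_real, Real.norm_of_nonneg ht.1]
    nlinarith [ht.2, norm_nonneg z]
  have hd : ∀ t ∈ Set.uIcc (0 : ℝ) 1,
      HasDerivAt (fun t : ℝ => F (t * z)) (psi μ ν (t * z) * z) t := by
    intro t ht
    have dl : HasDerivAt (fun s : ℝ => (s : ℂ) * z) z t := by
      simpa using (Complex.ofRealCLM.hasDerivAt (x := t)).mul_const z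
    exact (hF _ (hmem t ht)).comp t dl
  have hi : ContinuousOn (fun t : ℝ => psi μ ν (t * z) * z) (Set.uIcc 0 1) :=
    (hc.comp (by fun_prop) hmem).mul continuousOn_const
  rw [phi, intervalIntegral.integral_eq_sub_of_hasDerivAt hd hi.intervalIntegrable]
  simp [h0]

/-- `phi μ ν` maps the disk conformally onto a convex domain. -/
def HasConvexInverse (μ ν : ℝ) : Prop :=
  ∃ (Ω : Set ℂ) (Ψ : ℂ → ℂ), Convex ℝ Ω ∧ IsOpen Ω ∧ Set.MapsTo (phi μ ν) unitDisk Ω ∧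
    Set.MapsTo Ψ Ω unitDisk ∧ (∀ z ∈ unitDisk, Ψ (phi μ ν z) = z) ∧
    (∀ w ∈ Ω, phi μ ν (Ψ w) = w) ∧ DifferentiableOn ℂ Ψ Ω ∧
    ∀ z ∈ unitDisk, HasDerivAt (phi μ ν) (psi μ ν z) z

lemma hasConvexInverse_of_explicit {μ ν : ℝ} {F Ψ : ℂ → ℂ} {Ω : Set ℂ} (h0 : F 0 = 0)
    (hF : ∀ z ∈ unitDisk, HasDerivAt F (psi μ ν z) z) (hc : ContinuousOn (psi μ ν) unitDisk)
    (hΩc : Convex ℝ Ω) (hΩo : IsOpen Ω) (hFm : Set.MapsTo F unitDisk Ω)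
    (hΨm : Set.MapsTo Ψ Ω unitDisk) (hΨF : ∀ z ∈ unitDisk, Ψ (F z) = z)
    (hFΨ : ∀ w ∈ Ω, F (Ψ w) = w) (hΨd : DifferentiableOn ℂ Ψ Ω) : HasConvexInverse μ ν := by
  have heq : ∀ z ∈ unitDisk, phi μ ν z = F z := fun z hz => phi_eq_of_hasDerivAt h0 hF hc hz
  refine ⟨Ω, Ψ, hΩc, hΩo, ?_, hΨm, ?_, ?_, hΨd, ?_⟩
  · intro z hz; rw [heq z hz]; exact hFm hz
  · intro z hz; rw [heq z hz]; exact hΨF z hz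
  · intro w hw; rw [heq _ (hΨm hw)]; exact hFΨ w hw
  · intro z hz
    refine (hF z hz).congr_of_eventuallyEq ?_
    filter_upwards [isOpen_unitDisk.mem_nhds hz] with x hx using heq x hx

lemma one_sub_mul_ne_zero {a z : ℂ} (ha : ‖a‖ = 1) (hz : z ∈ unitDisk) : 1 - a * z ≠ 0 := by
  intro h
  rw [mem_unitDisk] at hz
  have : ‖a * z‖ = 1 := by rw [← sub_eq_zero.1 h]; simp
  rw [norm_mul, ha, one_mul] at this
  exact hz.ne this

lemma hasConvexInverse_of_psi_eq_sq {μ ν : ℝ} {a : ℂ} (ha : ‖a‖ = 1)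
    (hpsi : ∀ z, psi μ ν z = ((1 - a * z) ^ 2)⁻¹) : HasConvexInverse μ ν := by
  have hne : ∀ z ∈ unitDisk, 1 - a * z ≠ 0 := fun z hz => one_sub_mul_ne_zero ha hz
  have hhalf : ∀ w : ℂ, ‖w‖ < ‖1 + a * w‖ ↔ -1 < 2 * (a * w).re := by
    intro w
    have : ‖w‖ = ‖a * w‖ := by rw [norm_mul, ha, one_mul]
    rw [this, norm_lt_norm_add_iff]
    simp only [norm_one, map_one, one_mul]
    constructor <;> intro <;> linarith
  have hneΩ : ∀ w : ℂ, -1 < 2 * (a * w).re → 1 + a * w ≠ 0 := by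
    intro w hw h
    have := (hhalf w).2 hw
    rw [h, norm_zero] at this
    exact absurd this (norm_nonneg w).not_gt
  refine hasConvexInverse_of_explicit (F := fun z => z / (1 - a * z))
    (Ψ := fun w => w / (1 + a * w)) (Ω := {w | -1 < 2 * (a * w).re}) (by simp) ?_ ?_ ?_ ?_ ?_ ?_
    ?_ ?_ ?_
  · intro z hz
    have := (hasDerivAt_id z).div (((hasDerivAt_id z).const_mul a).const_sub 1) (hne z hz)
    rw [hpsi]
    refine this.congr_deriv ?_
    have h1 : 1 - z * a ≠ 0 := by rw [mul_comm]; exact hne z hz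
    simp only [id_eq, mul_comm a]
    field_simp
    ring
  · simp_rw [funext hpsi]
    refine ContinuousOn.inv₀ (by fun_prop) fun z hz => pow_ne_zero 2 (hne z hz)
  · intro w hw v hv c d hc hd hcd
    simp only [Set.mem_ofPred_eq] at *
    have : (a * (c • w + d • v)).re = c * (a * w).re + d * (a * v).re := by
      simp; ring
    rw [this]
    rcases hc.eq_or_lt with rfl | hc
    · have : d = 1 := by linarith
      subst this; linarith
    · nlinarith [mul_lt_mul_of_pos_left hw hc, mul_le_mul_of_nonneg_left hv.le hd]
  · exact isOpen_lt (by fun_prop) (by fun_prop)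
  · intro z hz
    have h1 := hne z hz
    rw [Set.mem_ofPred_eq, ← hhalf]
    have : 1 + a * (z / (1 - a * z)) = 1 / (1 - a * z) := by field_simp; ring
    rw [this, norm_div, norm_div, norm_one]
    exact div_lt_div_of_pos_right (mem_unitDisk.1 hz) (norm_pos_iff.2 h1)
  · intro w hw
    rw [mem_unitDisk, norm_div, div_lt_one (norm_pos_iff.2 (hneΩ w hw))]
    exact (hhalf w).2 hw
  · intro z hz
    have h1 := hne z hz
    have : 1 + a * (z / (1 - a * z)) = 1 / (1 - a * z) := by field_simp; ring
    simp only [this, div_div_div_cancel_right₀ h1, div_one]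
  · intro w hw
    have h1 := hneΩ w hw
    have : 1 - a * (w / (1 + a * w)) = 1 / (1 + a * w) := by field_simp; ring
    simp only [this, div_div_div_cancel_right₀ h1, div_one]
  · exact fun w hw => (DifferentiableAt.fun_div (c := fun w => w) (d := fun w => 1 + a * w)
      (by fun_prop) (by fun_prop) (hneΩ w hw)).differentiableWithinAt

lemma hasConvexInverse_of_psi_eq_mul {μ ν : ℝ} {p q : ℂ} (hp : ‖p‖ = 1) (hq : ‖q‖ = 1)
    (hqi : 0 < q.im)
    (hpsi : ∀ z, psi μ ν z = ((1 - p * q * z) * (1 - p * conj q * z))⁻¹) :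
    HasConvexInverse μ ν := by
  have hpp : p * conj p = 1 := by rw [Complex.mul_conj']; simp [hp]
  have hqq : q * conj q = 1 := by rw [Complex.mul_conj']; simp [hq]
  have hp0 : p ≠ 0 := left_ne_zero_of_mul_eq_one hpp
  have hq0 : q ≠ 0 := left_ne_zero_of_mul_eq_one hqq
  have hqc : q - conj q = 2 * Complex.I * q.im := by rw [Complex.sub_conj]; push_cast; ring
  have hqc0 : q - conj q ≠ 0 := by
    rw [hqc]; simp [hqi.ne']
  have ha : ∀ z ∈ unitDisk, 1 - p * q * z ≠ 0 := fun z hz =>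
    one_sub_mul_ne_zero (by rw [norm_mul, hp, hq, one_mul]) hz
  have hb : ∀ z ∈ unitDisk, 1 - p * conj q * z ≠ 0 := fun z hz =>
    one_sub_mul_ne_zero (by rw [norm_mul, hp, RCLike.norm_conj, hq, one_mul]) hz
  let N : ℂ → ℂ := fun z => -Complex.I * q * (1 - p * conj q * z) / (1 - p * q * z)
  have hN0 : N 0 = -Complex.I * q := by simp [N]
  have hNre : ∀ z ∈ unitDisk, 0 < (N z).re := by
    intro z hz
    have h1 := ha z hz
    have h2 : N z = (-Complex.I * q * (1 - p * conj q * z) * conj (1 - p * q * z)) /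
        ((‖1 - p * q * z‖ ^ 2 : ℝ) : ℂ) := by
      push_cast
      rw [← Complex.mul_conj']
      simp only [N]
      rw [mul_div_mul_right]
      rwa [Ne, map_eq_zero]
    rw [h2, Complex.div_ofReal_re]
    refine div_pos ?_ (by positivity)
    have h3 : -Complex.I * q * (1 - p * conj q * z) * conj (1 - p * q * z) =
        -Complex.I * (q + conj q * (z * conj z)) + Complex.I * (p * z + conj (p * z)) := by
      simp only [map_sub, map_mul, map_one]
      linear_combination (-Complex.I * conj q * z * conj z * (q * conj q) ) * hpp
        + (Complex.I * p * z + Complex.I * conj p * conj z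
          - Complex.I * conj q * z * conj z) * hqq
    rw [h3, Complex.add_conj, Complex.mul_conj]
    have h4 : Complex.normSq z < 1 := by
      rw [Complex.normSq_eq_norm_sq]
      have := mem_unitDisk.1 hz
      nlinarith [norm_nonneg z]
    simp
    nlinarith
  set c : ℂ := p * (q - conj q) with hc
  have hc0 : c ≠ 0 := mul_ne_zero hp0 hqc0
  set l : ℂ := Complex.log (-Complex.I * q) with hl
  let F : ℂ → ℂ := fun z => (Complex.log (N z) - l) / c
  let M : ℂ → ℂ := fun w => Complex.exp (c * w + l)
  let Ψ : ℂ → ℂ := fun w => (Complex.I * conj q * M w - 1) / (p * (Complex.I * M w - conj q))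
  have hMre : ∀ w, |(c * w + l).im| < Real.pi / 2 → 0 < (M w).re := by
    intro w hw
    rw [abs_lt] at hw
    simp only [M, Complex.exp_re]
    exact mul_pos (Real.exp_pos _) (Real.cos_pos_of_mem_Ioo hw)
  have hnorm : ∀ m : ℂ, 0 < m.re →
      ‖Complex.I * conj q * m - 1‖ < ‖p * (Complex.I * m - conj q)‖ := by
    intro m hm
    rw [norm_mul, hp, one_mul]
    have hq1 : q.re * q.re + q.im * q.im = 1 := by
      have := Complex.normSq_eq_norm_sq q
      rwa [hq, one_pow, Complex.normSq_apply] at this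
    rw [← sq_lt_sq₀ (norm_nonneg _) (norm_nonneg _), ← Complex.normSq_eq_norm_sq,
      ← Complex.normSq_eq_norm_sq, ← sub_pos]
    have : Complex.normSq (Complex.I * m - conj q) - Complex.normSq (Complex.I * conj q * m - 1)
        = 4 * (q.im * m.re) := by
      simp only [Complex.normSq_apply]
      simp
      linear_combination (1 - m.re ^ 2 - m.im ^ 2) * hq1
    rw [this]
    positivity
  have hden : ∀ m : ℂ, 0 < m.re → Complex.I * m - conj q ≠ 0 := by
    intro m hm h
    have := hnorm m hm
    rw [h, mul_zero, norm_zero] at this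
    exact absurd this (norm_nonneg _).not_gt
  have hΨm : Set.MapsTo Ψ {w | |(c * w + l).im| < Real.pi / 2} unitDisk := by
    intro w hw
    have hm := hMre w hw
    rw [mem_unitDisk, norm_div, div_lt_one]
    · exact hnorm _ hm
    · exact norm_pos_iff.2 (mul_ne_zero hp0 (hden _ hm))
  have hI2 := Complex.I_mul_I
  refine hasConvexInverse_of_explicit (F := F) (Ψ := Ψ)
    (Ω := {w | |(c * w + l).im| < Real.pi / 2}) ?_ ?_ ?_ ?_ ?_ ?_ hΨm ?_ ?_ ?_
  · simp [F, hN0, hl]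
  · intro z hz
    have h1 := ha z hz
    have h2 := hb z hz
    have hNs : N z ∈ Complex.slitPlane := Or.inl (hNre z hz)
    have hNne : N z ≠ 0 := Complex.slitPlane_ne_zero hNs
    have dN : HasDerivAt N _ z :=
      ((((hasDerivAt_id z).const_mul (p * conj q)).const_sub 1).const_mul (-Complex.I * q)).div
        (((hasDerivAt_id z).const_mul (p * q)).const_sub 1) h1
    have dF := ((dN.clog hNs).sub_const l).div_const c
    rw [hpsi]
    refine dF.congr_deriv ?_
    simp only [N, hc, id_eq]
    field_simp
    ring
  · rw [show psi μ ν = _ from funext hpsi]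
    exact ContinuousOn.inv₀ (by fun_prop) fun z hz => mul_ne_zero (ha z hz) (hb z hz)
  · have : {w | |(c * w + l).im| < Real.pi / 2} =
        (fun w => c * w) ⁻¹' ((fun w : ℂ => w.im) ⁻¹' Metric.ball (-l.im) (Real.pi / 2)) := by
      ext w; simp [Real.dist_eq]
    rw [this]
    exact ((convex_ball _ _).linear_preimage Complex.imLm).linear_preimage
      (LinearMap.mulLeft ℝ c)
  · exact isOpen_lt (by fun_prop) continuous_const
  · intro z hz
    have : c * F z + l = Complex.log (N z) := by simp only [F]; field_simp; ring
    rw [Set.mem_ofPred_eq, this, Complex.log_im, Complex.abs_arg_lt_pi_div_two_iff]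
    exact Or.inl (hNre z hz)
  · intro z hz
    have hNne : N z ≠ 0 := fun h => by have := hNre z hz; simp [h] at this
    have hMN : M (F z) = N z := by
      simp only [M]
      rw [show c * F z + l = Complex.log (N z) by simp only [F]; field_simp; ring,
        Complex.exp_log hNne]
    have h1 := ha z hz
    simp only [Ψ]
    rw [hMN, div_eq_iff (mul_ne_zero hp0 (hden _ (hNre z hz)))]
    have hNz : N z * (1 - p * q * z) = -Complex.I * q * (1 - p * conj q * z) :=
      div_mul_cancel₀ _ h1
    refine mul_right_cancel₀ h1 ?_
    linear_combination (Complex.I * conj q - z * p * Complex.I) * hNz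
      - (conj q - z * p) * q * (1 - p * conj q * z) * hI2 + (1 - p * conj q * z) * hqq
  · intro w hw
    have hm := hMre w hw
    have hd := hden _ hm
    have hNM : N (Ψ w) = M w := by
      have hΨ : Ψ w * (p * (Complex.I * M w - conj q)) = Complex.I * conj q * M w - 1 :=
        div_mul_cancel₀ _ (mul_ne_zero hp0 hd)
      simp only [N]
      rw [div_eq_iff (ha _ (hΨm hw))]
      refine mul_right_cancel₀ hd ?_
      linear_combination (Complex.I * q * conj q + M w * q) * hΨ
        - (q * M w - q * conj q ^ 2 * M w) * hI2 + (-M w * conj q + Complex.I * M w ^ 2) * hqq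
    simp only [F]
    rw [hNM]
    simp only [M]
    have hw' := abs_lt.1 (Set.mem_ofPred_eq.mp hw)
    rw [Complex.log_exp (by linarith [Real.pi_pos]) (by linarith [Real.pi_pos])]
    field_simp
    ring
  · have hMd : Differentiable ℂ M := by fun_prop
    exact fun w hw => (DifferentiableAt.fun_div (c := fun w => Complex.I * conj q * M w - 1)
      (d := fun w => p * (Complex.I * M w - conj q)) (by fun_prop) (by fun_prop)
      (mul_ne_zero hp0 (hden _ (hMre w hw)))).differentiableWithinAt

lemma psi_factor (μ ν : ℝ) (z : ℂ) :
    psi μ ν z = ((1 - Complex.exp (Complex.I * μ) * Complex.exp (Complex.I * ν) * z) *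
      (1 - Complex.exp (Complex.I * μ) * conj (Complex.exp (Complex.I * ν)) * z))⁻¹ := by
  have h1 : (2 * Real.cos ν : ℂ) =
      Complex.exp (Complex.I * ν) + conj (Complex.exp (Complex.I * ν)) := by
    rw [Complex.add_conj, mul_comm Complex.I, Complex.exp_ofReal_mul_I_re]; push_cast; ring
  have h2 : Complex.exp (Complex.I * ν) * conj (Complex.exp (Complex.I * ν)) = 1 := by
    rw [Complex.mul_conj', norm_exp_I_mul]; simp
  rw [psi, exp_two_I_mul]
  congr 1
  linear_combination (-z * Complex.exp (Complex.I * μ)) * h1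
    - (Complex.exp (Complex.I * μ) ^ 2 * z ^ 2) * h2

theorem hasConvexInverse (μ ν : ℝ) : HasConvexInverse μ ν := by
  have hp := norm_exp_I_mul μ
  have hq := norm_exp_I_mul ν
  have hf := psi_factor μ ν
  generalize Complex.exp (Complex.I * μ) = p at *
  generalize Complex.exp (Complex.I * ν) = q at *
  rcases lt_trichotomy q.im 0 with h | h | h
  · refine hasConvexInverse_of_psi_eq_mul (q := conj q) hp (by rwa [RCLike.norm_conj])
      (by simpa using h) fun z => ?_
    rw [hf, Complex.conj_conj, mul_comm]
  · refine hasConvexInverse_of_psi_eq_sq (a := p * q) (by rw [norm_mul, hp, hq, one_mul])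
      fun z => ?_
    rw [hf, Complex.conj_eq_iff_im.2 h, sq]
  · exact hasConvexInverse_of_psi_eq_mul hp hq h hf

lemma ClassH.shear_deriv {μ ν γ : ℝ} {h g : ℂ → ℂ} (hf : ClassH h g)
    (hshear : ∀ z ∈ unitDisk, h z - Complex.exp (2 * Complex.I * γ) * g z = phi μ ν z)
    {z : ℂ} (hz : z ∈ unitDisk) :
    deriv h z = psi μ ν z + Complex.exp (2 * Complex.I * γ) * deriv g z := by
  obtain ⟨-, -, -, -, -, -, -, -, -, hφ⟩ := hasConvexInverse μ ν
  have hD := isOpen_unitDisk.mem_nhds hz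
  have := (hf.analytic_h.differentiableAt hD).hasDerivAt.sub
    ((hf.analytic_g.differentiableAt hD).hasDerivAt.const_mul (Complex.exp (2 * Complex.I * γ)))
  rw [← this.unique ((hφ z hz).congr_of_eventuallyEq (by
    filter_upwards [hD] with x hx using hshear x hx))]
  ring

lemma ClassH.norm_deriv_lt {h g : ℂ → ℂ} (hf : ClassH h g) {z : ℂ} (hz : z ∈ unitDisk) :
    ‖deriv g z‖ < ‖deriv h z‖ :=
  (sensePreserving_harmonicMap_iff hf.analytic_h hf.analytic_g).1 hf.sensePreserving z hz

lemma hasDerivAt_combo {u₁ u₂ : ℂ → ℂ} {z : ℂ} (η : ℂ) (h₁ : DifferentiableAt ℂ u₁ z)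
    (h₂ : DifferentiableAt ℂ u₂ z) :
    HasDerivAt (combo η u₁ u₂) (η * deriv u₁ z + (1 - η) * deriv u₂ z) z :=
  (h₁.hasDerivAt.const_mul η).add (h₂.hasDerivAt.const_mul (1 - η))

lemma differentiableOn_combo {u₁ u₂ : ℂ → ℂ} {s : Set ℂ} (η : ℂ) (h₁ : DifferentiableOn ℂ u₁ s)
    (h₂ : DifferentiableOn ℂ u₂ s) : DifferentiableOn ℂ (combo η u₁ u₂) s :=
  (h₁.const_mul η).add (h₂.const_mul (1 - η))

lemma norm_exp_two_I_mul_mul (γ : ℝ) (x : ℂ) : ‖Complex.exp (2 * Complex.I * γ) * x‖ = ‖x‖ := by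
  rw [exp_two_I_mul, norm_mul, norm_pow, norm_exp_I_mul, one_pow, one_mul]

lemma ClassH.deriv_g_zero {μ ν γ : ℝ} {h g : ℂ → ℂ} (hf : ClassH h g)
    (hshear : ∀ z ∈ unitDisk, h z - Complex.exp (2 * Complex.I * γ) * g z = phi μ ν z) :
    deriv g 0 = 0 := by
  have := hf.shear_deriv hshear zero_mem_unitDisk
  rw [hf.deriv_h_zero] at this
  simpa [psi] using this

/-- A combination of two shears of `phi μ ν` is univalent and convex in the direction of the shear
as soon as the two derivatives satisfy the corresponding inequality. -/
theorem classSH0_combo {μ ν γ : ℝ} {h₁ g₁ h₂ g₂ : ℂ → ℂ} (hf₁ : ClassH h₁ g₁) (hf₂ : ClassH h₂ g₂)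
    (hshear₁ : ∀ z ∈ unitDisk, h₁ z - Complex.exp (2 * Complex.I * γ) * g₁ z = phi μ ν z)
    (hshear₂ : ∀ z ∈ unitDisk, h₂ z - Complex.exp (2 * Complex.I * γ) * g₂ z = phi μ ν z)
    {η : ℂ} (hη : ∀ z ∈ unitDisk, ∀ P X₁ X₂ : ℂ, ‖X₁‖ < ‖P + X₁‖ → ‖X₂‖ < ‖P + X₂‖ →
      ‖X₁‖ = ‖deriv g₁ z‖ → ‖X₂‖ = ‖deriv g₂ z‖ → P + X₁ = deriv h₁ z → P + X₂ = deriv h₂ z →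
      ‖η * X₁ + (1 - η) * X₂‖ < ‖P + (η * X₁ + (1 - η) * X₂)‖) :
    ClassSH0 (combo η h₁ h₂) (combo η g₁ g₂) ∧
      ConvexInDirection γ (harmonicMap (combo η h₁ h₂) (combo η g₁ g₂)) := by
  obtain ⟨Ω, Ψ, hΩc, hΩo, hΦm, hΨm, hΨΦ, hΦΨ, hΨd, hΦd⟩ := hasConvexInverse μ ν
  have hh := differentiableOn_combo η hf₁.analytic_h hf₂.analytic_h
  have hg := differentiableOn_combo η hf₁.analytic_g hf₂.analytic_g
  have dh : ∀ z ∈ unitDisk, deriv (combo η h₁ h₂) z = η * deriv h₁ z + (1 - η) * deriv h₂ z :=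
    fun z hz => (hasDerivAt_combo η
      (hf₁.analytic_h.differentiableAt (isOpen_unitDisk.mem_nhds hz))
      (hf₂.analytic_h.differentiableAt (isOpen_unitDisk.mem_nhds hz))).deriv
  have dg : ∀ z ∈ unitDisk, deriv (combo η g₁ g₂) z = η * deriv g₁ z + (1 - η) * deriv g₂ z :=
    fun z hz => (hasDerivAt_combo η
      (hf₁.analytic_g.differentiableAt (isOpen_unitDisk.mem_nhds hz))
      (hf₂.analytic_g.differentiableAt (isOpen_unitDisk.mem_nhds hz))).deriv
  have hlt : ∀ z ∈ unitDisk, ‖deriv (combo η g₁ g₂) z‖ < ‖deriv (combo η h₁ h₂) z‖ := by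
    intro z hz
    have e₁ := hf₁.shear_deriv hshear₁ hz
    have e₂ := hf₂.shear_deriv hshear₂ hz
    have n₁ := norm_exp_two_I_mul_mul γ (deriv g₁ z)
    have n₂ := norm_exp_two_I_mul_mul γ (deriv g₂ z)
    have := hη z hz _ _ _ (by rw [n₁, ← e₁]; exact hf₁.norm_deriv_lt hz)
      (by rw [n₂, ← e₂]; exact hf₂.norm_deriv_lt hz) n₁ n₂ e₁.symm e₂.symm
    rw [dg z hz, dh z hz, ← norm_exp_two_I_mul_mul γ, e₁, e₂]
    convert this using 2 <;> ring
  have hs : ∀ z ∈ unitDisk, combo η h₁ h₂ z - Complex.exp (2 * Complex.I * γ) * combo η g₁ g₂ z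
      = phi μ ν z := by
    intro z hz
    simp only [combo]
    linear_combination η * hshear₁ z hz + (1 - η) * hshear₂ z hz
  obtain ⟨hinj, hconv⟩ := shear hΩc hΩo hΦm hΨm hΨΦ hΦΨ hΨd hΦd hh hg hs hlt
  refine ⟨⟨⟨⟨hh, hg, fun z hz => ⟨_, isOpen_unitDisk.mem_nhds hz, hinj⟩,
    (sensePreserving_harmonicMap_iff hh hg).2 hlt, ?_, ?_⟩, hinj⟩, ?_⟩, hconv⟩
  · simp [combo, hf₁.h_zero, hf₂.h_zero]
  · rw [dh 0 zero_mem_unitDisk, hf₁.deriv_h_zero, hf₂.deriv_h_zero]; ring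
  · rw [dg 0 zero_mem_unitDisk, hf₁.deriv_g_zero hshear₁, hf₂.deriv_g_zero hshear₂]; ring

end HarmonicMapping

theorem mainTheorem7 (μ ν φ : ℝ) (h₁ g₁ h₂ g₂ : ℂ → ℂ)
    (hf₁ : HarmonicMapping.ClassH h₁ g₁) (hf₂ : HarmonicMapping.ClassH h₂ g₂)
    (hshear₁ : ∀ z ∈ HarmonicMapping.unitDisk,
      h₁ z - Complex.exp (2 * Complex.I * φ) * g₁ z = HarmonicMapping.phi μ ν z)
    (hshear₂ : ∀ z ∈ HarmonicMapping.unitDisk,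
      h₂ z - Complex.exp (2 * Complex.I * φ) * g₂ z = HarmonicMapping.phi μ ν z) :
    (∀ η : ℝ, 0 ≤ η → η ≤ 1 →
      HarmonicMapping.ClassSH0
          (HarmonicMapping.combo (η : ℂ) h₁ h₂) (HarmonicMapping.combo (η : ℂ) g₁ g₂) ∧
        HarmonicMapping.ConvexInDirection φ
          (HarmonicMapping.harmonicMap
            (HarmonicMapping.combo (η : ℂ) h₁ h₂) (HarmonicMapping.combo (η : ℂ) g₁ g₂))) ∧
    (∀ α₁ α₂ : ℝ, α₁ ≤ 1 → α₂ ≤ 1 →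
      (∀ z ∈ HarmonicMapping.unitDisk, ‖HarmonicMapping.dilatation h₁ g₁ z‖ < α₁) →
      (∀ z ∈ HarmonicMapping.unitDisk, ‖HarmonicMapping.dilatation h₂ g₂ z‖ < α₂) →
      ∀ η : ℂ, ‖η‖ ≤ (1 - α₁) * (1 - α₂) / (2 * (α₁ + α₂)) →
        HarmonicMapping.ClassSH0
            (HarmonicMapping.combo η h₁ h₂) (HarmonicMapping.combo η g₁ g₂) ∧
          HarmonicMapping.ConvexInDirection φ
            (HarmonicMapping.harmonicMap
              (HarmonicMapping.combo η h₁ h₂) (HarmonicMapping.combo η g₁ g₂))) := by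
  refine ⟨fun η h0 h1 => ?_, fun α₁ α₂ _ hα₂ hω₁ hω₂ η hη => ?_⟩
  · exact HarmonicMapping.classSH0_combo hf₁ hf₂ hshear₁ hshear₂
      fun z _ P X₁ X₂ hX₁ hX₂ _ _ _ _ =>
        HarmonicMapping.norm_combo_lt_of_mem_Icc hX₁ hX₂ h0 h1
  · refine HarmonicMapping.classSH0_combo hf₁ hf₂ hshear₁ hshear₂
      fun z hz P X₁ X₂ hX₁ hX₂ hn₁ hn₂ he₁ he₂ => ?_
    refine HarmonicMapping.norm_combo_lt_of_norm_le hα₂ hX₁ hX₂ ?_ ?_ hη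
    · have := hω₁ z hz
      rwa [HarmonicMapping.dilatation, norm_div, ← hn₁, ← he₁,
        div_lt_iff₀ ((norm_nonneg _).trans_lt hX₁)] at this
    · have := hω₂ z hz
      rwa [HarmonicMapping.dilatation, norm_div, ← hn₂, ← he₂,
        div_lt_iff₀ ((norm_nonneg _).trans_lt hX₂)] at this
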